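/- Let $k\ge 0$ and $N$ be integers with $k<N-1$, let $\frac{k}{k+1}<\sigma\le 1$, and let $\varphi:\mathbb S^k\to\mathbb R^N$ be a $C^\sigma$-embedding, i.e. a topological embedding that is $\sigma$-Hölder continuous. A smooth approximation of $\varphi$ is a family $(\varphi_\varepsilon)_{\varepsilon>0}$ of smooth maps $\varphi_\varepsilon:\mathbb S^k\to\mathbb R^N$ with $\varphi_\varepsilon\to\varphi$ in $C^\beta(\mathbb S^k,\mathbb R^N)$ as $\varepsilon\to0^+$ for every $0<\beta<\sigma$. For an exact $(k+1)$-form $\eta=d\omega$ on $\mathbb R^N$, with $\omega$ a smooth $k$-form, the (analytic) linking number of $\varphi(\mathbb S^k)$ and $\eta$ is $$\mathcal L(\varphi(\mathbb S^k),\eta):=\lim_{\varepsilon\to0^+}\int_{\mathbb S^k}\varphi_\varepsilon^*\omega,$$ where $\mathbb S^k$ carries its standard orientation (for $k=0$ the integral is the value at $+1$ minus the value at $-1$). Then there is a smooth $k$-form $\omega$ on $\mathbb R^N$ such that $\mathcal L(\varphi(\mathbb S^k),d\omega)$ is well defined and $\mathcal L(\varphi(\mathbb S^k),d\omega)\neq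 0$. That is: smooth approximations of $\varphi$ exist, and there is a real number $L\neq0$ such that $\lim_{\varepsilon\to0^+}\int_{\mathbb S^k}\varphi_\varepsilon^*\omega'=L$ for every smooth $k$-form $\omega'$ with $d\omega'=d\omega$ and for every smooth approximation $(\varphi_\varepsilon)$ of $\varphi$. -/

import Mathlib

open MeasureTheory Filter Topology Set
open scoped NNReal Manifold

noncomputable section

/-- Euclidean space `ℝⁿ`. -/
abbrev Euc (n : ℕ) : Type := EuclideanSpace ℝ (Fin n)

/-- The unit sphere `𝕊ᵏ ⊂ ℝᵏ⁺¹`. -/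
abbrev Sph (k : ℕ) : Type := Metric.sphere (0 : Euc (k + 1)) 1

/-- Differential `k`-forms on `ℝᴺ` (no regularity imposed). -/
abbrev DForm (N k : ℕ) : Type := Euc N → (Euc N) [⋀^Fin k]→L[ℝ] ℝ

/-- The `0`-homogeneous extension `x ↦ f (x / |x|)` of a map on `𝕊ᵏ` to `ℝᵏ⁺¹ \ {0}`, that is
`f` composed with the radial retraction onto the sphere (with the irrelevant value `0` at `0`). -/
def radialExt {k N : ℕ} (f : Sph k → Euc N) (x : Euc (k + 1)) : Euc N :=
  if h : x = 0 then 0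
  else f ⟨‖x‖⁻¹ • x, by simp [norm_smul, h]⟩

/-- The pullback `f^* ω` at `x ∈ 𝕊ᵏ`. The derivative of `radialExt f` at `x` is the differential
`df_x` on the tangent space `x^⊥` and vanishes in the radial direction; so this alternating form
on `ℝᵏ⁺¹` is the pullback by `df_x`, precomposed with the orthogonal projection onto `x^⊥`. -/
def spherePullback {k N : ℕ} (f : Sph k → Euc N) (ω : DForm N k) (x : Sph k) :
    (Euc (k + 1)) [⋀^Fin k]→L[ℝ] ℝ :=
  (ω (f x)).compContinuousLinearMap (fderiv ℝ (radialExt f) x)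

/-- The value of an alternating `k`-form `α` on a positively oriented orthonormal basis of the
tangent space `x^⊥` of `𝕊ᵏ` at `x` (outward normal first), written without choosing a basis:
it is `(x^♭ ∧ α)(e₀, …, e_k) = ∑ᵢ (-1)ⁱ xᵢ α(e₀, …, êᵢ, …, e_k)`. For `k = 0` it is `x₀ α`, which
gives the points `±1` of `𝕊⁰` the signs `±1`. -/
def sphereDensity {k : ℕ} (x : Sph k) (α : (Euc (k + 1)) [⋀^Fin k]→L[ℝ] ℝ) : ℝ :=
  ∑ i : Fin (k + 1), (-1 : ℝ) ^ (i : ℕ) * (x : Euc (k + 1)) i *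
    α (fun j => EuclideanSpace.single (i.succAbove j) (1 : ℝ))

/-- The integral `∫_{𝕊ᵏ} f^* ω` over the oriented sphere; `volume.toSphere` is the surface
measure of `𝕊ᵏ` (the counting measure for `k = 0`). -/
def sphereIntegral {k N : ℕ} (f : Sph k → Euc N) (ω : DForm N k) : ℝ :=
  ∫ x : Sph k, sphereDensity x (spherePullback f ω x)
    ∂((volume : Measure (Euc (k + 1))).toSphere)

/-- `ψ ε → φ` in the Hölder space `C^β(𝕊ᵏ, ℝᴺ)` as `ε → 0⁺`: the supremum norm and the
`β`-Hölder seminorm of `ψ ε - φ` tend to `0`. -/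
def TendstoHolder {k N : ℕ} (β : ℝ≥0) (ψ : ℝ → Sph k → Euc N) (φ : Sph k → Euc N) : Prop :=
  ∀ δ : ℝ, 0 < δ → ∀ᶠ ε in 𝓝[>] (0 : ℝ),
    (∀ x, ‖ψ ε x - φ x‖ ≤ δ) ∧
    ∀ x y, ‖(ψ ε x - φ x) - (ψ ε y - φ y)‖ ≤ δ * dist x y ^ (β : ℝ)

/-- `(ψ ε)_{ε > 0}` is a smooth approximation of the `C^σ` map `φ`: every `ψ ε` is smooth, and
`ψ ε → φ` in `C^β` for every `β < σ`. (Every family of smooth maps converging in `C^σ`, or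
converging uniformly with bounded `C^σ` norms, such as mollifications, is of this kind. In the
norm of `C^σ` itself a general `C^σ` map has no smooth approximation.) -/
structure IsSmoothApprox {k N : ℕ} (σ : ℝ≥0) (φ : Sph k → Euc N) (ψ : ℝ → Sph k → Euc N) :
    Prop where
  smooth : ∀ ε : ℝ, 0 < ε → ContMDiff (𝓡 k) 𝓘(ℝ, Euc N) ((⊤ : ℕ∞) : WithTop ℕ∞) (ψ ε)
  tendsto : ∀ β : ℝ≥0, 0 < β → β < σ → TendstoHolder β ψ φ

/-- `L` is the (analytic) linking number `𝓛(φ(𝕊ᵏ), η) = lim_{ε → 0} ∫_{𝕊ᵏ} φ_ε^* ω` of the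
`C^σ` map `φ` and the exact smooth `(k+1)`-form `η = dω`: the limit exists and is `L` for every
smooth primitive `ω` of `η` and every smooth approximation of `φ`. The first two fields say that
there are such `ω` and such approximations, so that `L` is determined by `φ` and `η`. -/
structure HasLinkingNumber {k N : ℕ} (σ : ℝ≥0) (φ : Sph k → Euc N) (η : DForm N (k + 1)) (L : ℝ) :
    Prop where
  exact : ∃ ω : DForm N k, ContDiff ℝ ((⊤ : ℕ∞) : WithTop ℕ∞) ω ∧ extDeriv ω = η
  approx : ∃ ψ : ℝ → Sph k → Euc N, IsSmoothApprox σ φ ψ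
  tendsto : ∀ ω : DForm N k, ContDiff ℝ ((⊤ : ℕ∞) : WithTop ℕ∞) ω → extDeriv ω = η →
    ∀ ψ : ℝ → Sph k → Euc N, IsSmoothApprox σ φ ψ →
      Tendsto (fun ε => sphereIntegral (ψ ε) ω) (𝓝[>] (0 : ℝ)) (𝓝 L)

end

/-!
The idea is to find a form `ω` that is closed near the embedded sphere `φ(𝕊ᵏ)` and measures the
degree of its parametrization. As `φ` is an embedding, a smooth map `G : ℝᴺ → ℝᵏ⁺¹` with `G ∘ φ`
uniformly close to `x ↦ 4 x` exists (`exists_contDiff_approx_of_isEmbedding`). Let `θ` be a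
smooth `k`-form on `ℝᵏ⁺¹` equal to the solid angle form outside the ball of radius `2`, where it is
closed (`extDeriv_pullback_smoothDir`), and put `ω = G^* θ`.

If `ψ` is smooth and uniformly close to `φ`, then `∫ ψ^* ω = ∫ (G ∘ ψ)^* θ`, and `G ∘ ψ` is
joined to `x ↦ 4 x` by segments that stay outside the ball of radius `2`. By homotopy invariance
(`sphereIntegral_eq_of_closed_segment`) the integral is the area of the unit sphere, which is
positive (`sphereIntegral_coe_volForm_pos`). So along every smooth approximation the integrals are
eventually constant. Another primitive of `dω` differs from `ω` by a closed form on `ℝᴺ`, whose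
integral over a smooth sphere vanishes because the sphere contracts to a point
(`sphereIntegral_eq_of_extDeriv_eq`). Smooth approximations exist by mollification
(`exists_isSmoothApprox`).

Stokes' theorem enters only for compactly supported forms on `ℝᵏ⁺¹`. In polar coordinates, the
integral of `h(|x|) d|x| ∧ F^* ω`, with `F` the radial extension of `f`, is `(∫ h) ∫ f^* ω`
(`integral_radial_wedge_pullback`), so a homotopy spread over an annulus compares the integrals
over its two boundary spheres.
-/

/-! ### Regularity of form-valued maps -/

/-- A form-valued map is `C^r` as soon as all its evaluations are: in finite dimension a form is a
linear function of its values on basis vectors. -/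
theorem contDiffAt_alternating_of_forall_apply {X : Type*} [NormedAddCommGroup X] [NormedSpace ℝ X]
    {n k : ℕ} {r : WithTop ℕ∞} {β : X → (Euc n) [⋀^Fin k]→L[ℝ] ℝ} {x : X}
    (h : ∀ v, ContDiffAt ℝ r (fun y => β y v) x) : ContDiffAt ℝ r β x := by
  let b := (EuclideanSpace.basisFun (Fin n) ℝ).toBasis
  let Φ : ((Euc n) [⋀^Fin k]→L[ℝ] ℝ) →ₗ[ℝ] ((Fin k → Fin n) → ℝ) :=
    { toFun := fun α s => α (fun j => b (s j))
      map_add' := fun _ _ => rfl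
      map_smul' := fun _ _ => rfl }
  -- A linear left inverse of the injection `Φ` recovers `β` from its coefficients.
  have hΦ : Φ.ker = ⊥ := by
    refine LinearMap.ker_eq_bot.2 fun α α' hαα' => ?_
    apply ContinuousAlternatingMap.toAlternatingMap_injective
    exact b.ext_alternating fun s _ => congrFun hαα' s
  obtain ⟨Ψ, hΨ⟩ := Φ.exists_leftInverse_of_injective hΦ
  have hβ : β = fun y => LinearMap.toContinuousLinearMap Ψ (Φ (β y)) :=
    funext fun y => (LinearMap.congr_fun hΨ (β y)).symm
  rw [hβ]
  exact (LinearMap.toContinuousLinearMap Ψ).contDiff.contDiffAt.comp x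
    (contDiffAt_pi.2 fun s => h _)

theorem ContDiffAt.alternating_compContinuousLinearMap {X F : Type*} [NormedAddCommGroup X]
    [NormedSpace ℝ X] [NormedAddCommGroup F] [NormedSpace ℝ F] {n k : ℕ} {r : WithTop ℕ∞}
    {α : X → F [⋀^Fin k]→L[ℝ] ℝ} {A : X → Euc n →L[ℝ] F} {x : X}
    (hα : ContDiffAt ℝ r α x) (hA : ContDiffAt ℝ r A x) :
    ContDiffAt ℝ r (fun y => (α y).compContinuousLinearMap (A y)) x := by
  refine contDiffAt_alternating_of_forall_apply fun v => ?_
  let J : (F [⋀^Fin k]→L[ℝ] ℝ) →L[ℝ] ContinuousMultilinearMap ℝ (fun _ : Fin k => F) ℝ :=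
    ContinuousAlternatingMap.toContinuousMultilinearMapLI.toContinuousLinearMap
  have h1 : ContDiffAt ℝ r (fun y => J (α y)) x := J.contDiff.contDiffAt.comp x hα
  have h2 : ContDiffAt ℝ r (fun y =>
      ContinuousMultilinearMap.compContinuousLinearMapContinuousMultilinear ℝ
        (fun _ : Fin k => Euc n) (fun _ : Fin k => F) ℝ (fun _ => A y)) x :=
    (ContinuousMultilinearMap.contDiff _).contDiffAt.comp x (contDiffAt_pi.2 fun _ => hA)
  exact (ContinuousMultilinearMap.apply ℝ (fun _ : Fin k => Euc n) ℝ v).contDiff.contDiffAt.comp x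
    (h2.clm_apply h1)

/-! ### Stokes' theorem for compactly supported forms -/

theorem integral_fderiv_apply_eq_zero {n : ℕ} {g : Euc n → ℝ} (hg : ContDiff ℝ 1 g)
    (hc : HasCompactSupport g) (v : Euc n) : ∫ x, fderiv ℝ g x v = 0 := by
  have h := integral_mul_fderiv_eq_neg_fderiv_mul_of_integrable (μ := (volume : Measure (Euc n)))
    (f := fun _ => (1 : ℝ)) (g := g) (v := v) (by simp)
    (by
      simp only [one_mul]
      exact ((hg.continuous_fderiv one_ne_zero).clm_apply
        continuous_const).integrable_of_hasCompactSupport (hc.fderiv_apply ℝ v))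
    (by simpa using hg.continuous.integrable_of_hasCompactSupport hc)
    (fun x _ => differentiableAt_const _) (fun x _ => hg.differentiable one_ne_zero x)
  simpa using h

/-- Stokes' theorem for a compactly supported form of codegree one: in coordinates `dγ` is a sum
of partial derivatives of compactly supported functions. -/
theorem integrable_extDeriv_and_integral_eq_zero {k : ℕ} {γ : DForm (k + 1) k}
    (hγ : ContDiff ℝ 1 γ) (hc : HasCompactSupport γ) (v : Fin (k + 1) → Euc (k + 1)) :
    Integrable (fun x => extDeriv γ x v) ∧ ∫ x, extDeriv γ x v = 0 := by
  have hd : ∀ w : Fin k → Euc (k + 1), ContDiff ℝ 1 fun x => γ x w := fun w =>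
    (ContinuousAlternatingMap.apply ℝ (Euc (k + 1)) ℝ w).contDiff.comp hγ
  have hs : ∀ w : Fin k → Euc (k + 1), HasCompactSupport fun x => γ x w := fun w =>
    hc.comp_left (g := fun α : (Euc (k + 1)) [⋀^Fin k]→L[ℝ] ℝ => α w) rfl
  simp_rw [extDeriv_apply (hγ.differentiable one_ne_zero _), zsmul_eq_mul]
  have hi : ∀ i ∈ (Finset.univ : Finset (Fin (k + 1))), Integrable (fun x =>
      (((-1) ^ (i : ℕ) : ℤ) : ℝ) *
      fderiv ℝ (fun y => γ y (i.removeNth v)) x (v i)) := fun i _ =>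
    ((((hd (i.removeNth v)).continuous_fderiv one_ne_zero).clm_apply
      continuous_const).integrable_of_hasCompactSupport ((hs _).fderiv_apply ℝ (v i))).const_mul _
  refine ⟨integrable_finsetSum _ hi, ?_⟩
  rw [integral_finsetSum _ hi]
  refine Finset.sum_eq_zero fun i _ => ?_
  rw [integral_const_mul, integral_fderiv_apply_eq_zero (hd _) (hs _), mul_zero]

/-- Stokes' theorem for `d(uβ) = du ∧ β`, where `u` is a compactly supported function and `β` is
closed on the support of `u`. The sum is `(du ∧ β)(v₀, …, v_k)`; `β` need not be regular, nor
closed, away from the support of `u`. -/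
theorem integrable_wedge_and_integral_eq_zero {k : ℕ} {u : Euc (k + 1) → ℝ} {β : DForm (k + 1) k}
    (hu : ContDiff ℝ 1 u) (hc : HasCompactSupport u) (hβ : ∀ x ∈ tsupport u, ContDiffAt ℝ 1 β x)
    (hd : ∀ x ∈ tsupport u, extDeriv β x = 0) (v : Fin (k + 1) → Euc (k + 1)) :
    Integrable (fun x => ∑ i : Fin (k + 1),
      (-1 : ℝ) ^ (i : ℕ) * fderiv ℝ u x (v i) * β x (i.removeNth v)) ∧
    ∫ x, ∑ i : Fin (k + 1), (-1 : ℝ) ^ (i : ℕ) * fderiv ℝ u x (v i) * β x (i.removeNth v) = 0 := by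
  have hγ : ContDiff ℝ 1 (fun x => u x • β x) := by
    refine contDiff_iff_contDiffAt.2 fun x => ?_
    by_cases hx : x ∈ tsupport u
    · exact hu.contDiffAt.smul (hβ x hx)
    · refine (contDiffAt_const (c := 0)).congr_of_eventuallyEq ?_
      filter_upwards [(isClosed_tsupport u).isOpen_compl.mem_nhds hx] with y hy
      simp [image_eq_zero_of_notMem_tsupport hy]
  suffices h : (fun x => ∑ i : Fin (k + 1),
      (-1 : ℝ) ^ (i : ℕ) * fderiv ℝ u x (v i) * β x (i.removeNth v)) =
      fun x => extDeriv (fun x => u x • β x) x v by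
    rw [h]
    exact integrable_extDeriv_and_integral_eq_zero hγ hc.smul_right v
  funext x
  by_cases hx : x ∈ tsupport u
  · have hβx := (hβ x hx).differentiableAt one_ne_zero
    have hux := hu.differentiable one_ne_zero x
    have hdx : extDeriv β x v = 0 := by rw [hd x hx]; rfl
    rw [extDeriv_apply hβx] at hdx
    rw [extDeriv_apply (hux.fun_smul hβx)]
    have : ∀ i : Fin (k + 1), fderiv ℝ (fun y => (u y • β y) (i.removeNth v)) x (v i) =
        u x * fderiv ℝ (fun y => β y (i.removeNth v)) x (v i) +
          fderiv ℝ u x (v i) * β x (i.removeNth v) := fun i => by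
      have h1 : DifferentiableAt ℝ (fun y => β y (i.removeNth v)) x := by
        exact ((ContinuousAlternatingMap.apply ℝ (Euc (k + 1)) ℝ
          (i.removeNth v)).differentiableAt).comp x hβx
      have h2 : (fun y => (u y • β y) (i.removeNth v)) =
          fun y => u y * (fun y => β y (i.removeNth v)) y := rfl
      rw [h2, fderiv_fun_mul hux h1]
      simp [mul_comm]
    simp only [this, zsmul_eq_mul, mul_add, Finset.sum_add_distrib, Int.cast_pow, Int.cast_neg,
      Int.cast_one]
    simp only [zsmul_eq_mul, Int.cast_pow, Int.cast_neg, Int.cast_one] at hdx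
    have h3 : ∑ i : Fin (k + 1), (-1 : ℝ) ^ (i : ℕ) *
        (u x * fderiv ℝ (fun y => β y (i.removeNth v)) x (v i)) = 0 := by
      rw [← mul_zero (u x), ← hdx, Finset.mul_sum]
      exact Finset.sum_congr rfl fun i _ => by ring
    rw [h3, zero_add]
    exact Finset.sum_congr rfl fun i _ => by ring
  · have h1 : u =ᶠ[𝓝 x] fun _ => 0 := by
      filter_upwards [(isClosed_tsupport u).isOpen_compl.mem_nhds hx] with y hy
      exact image_eq_zero_of_notMem_tsupport hy
    have h2 : (fun y => u y • β y) =ᶠ[𝓝 x] fun _ => 0 := by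
      filter_upwards [h1] with y hy
      simp [hy]
    rw [h2.extDeriv_eq]
    simp [h1.fderiv_eq, extDeriv, ContinuousAlternatingMap.alternatizeUncurryFin_apply]

/-! ### The radial extension and the integral over the sphere -/

theorem radialExt_of_ne {k N : ℕ} (f : Sph k → Euc N) {x : Euc (k + 1)} (hx : x ≠ 0) :
    radialExt f x = f ⟨‖x‖⁻¹ • x, by simp [norm_smul, hx]⟩ := by
  simp [radialExt, hx]

theorem radialExt_coe {k N : ℕ} (f : Sph k → Euc N) (x : Sph k) : radialExt f x = f x := by
  rw [radialExt_of_ne f (ne_zero_of_mem_unit_sphere x)]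
  congr
  simp

theorem radialExt_smul {k N : ℕ} (f : Sph k → Euc N) {c : ℝ} (hc : 0 < c) (x : Euc (k + 1)) :
    radialExt f (c • x) = radialExt f x := by
  by_cases hx : x = 0
  · simp [hx]
  rw [radialExt_of_ne f hx, radialExt_of_ne f (smul_ne_zero hc.ne' hx)]
  congr 2
  rw [norm_smul, Real.norm_of_nonneg hc.le, smul_smul]
  congr 1
  field_simp

theorem contMDiff_coe_sph (k : ℕ) : ContMDiff (𝓡 k) 𝓘(ℝ, Euc (k + 1)) ((⊤ : ℕ∞) : WithTop ℕ∞)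
    ((↑) : Sph k → Euc (k + 1)) :=
  have := Fact.mk (finrank_euclideanSpace_fin (𝕜 := ℝ) (n := k + 1))
  contMDiff_coe_sphere

/-- The radial extension of a smooth map is smooth away from the origin, being its composition with
the smooth retraction `x ↦ x / |x|` onto the sphere. -/
theorem contDiffAt_radialExt {k N : ℕ} {f : Sph k → Euc N}
    (hf : ContMDiff (𝓡 k) 𝓘(ℝ, Euc N) ((⊤ : ℕ∞) : WithTop ℕ∞) f) {x : Euc (k + 1)} (hx : x ≠ 0) :
    ContDiffAt ℝ ((⊤ : ℕ∞) : WithTop ℕ∞) (radialExt f) x := by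
  let U : TopologicalSpace.Opens (Euc (k + 1)) := ⟨{0}ᶜ, isOpen_compl_singleton⟩
  let ν : Euc (k + 1) → Euc (k + 1) := fun y => ‖y‖⁻¹ • y
  have hν : ∀ y : U, ν y ∈ Metric.sphere (0 : Euc (k + 1)) 1 := fun y => by
    have : (y : Euc (k + 1)) ≠ 0 := y.2
    simp [ν, norm_smul, this]
  have h1 : ContMDiff 𝓘(ℝ, Euc (k + 1)) 𝓘(ℝ, Euc (k + 1)) ((⊤ : ℕ∞) : WithTop ℕ∞)
      (fun y : U => ν y) := fun y => by
    rw [contMDiffAt_subtype_iff (f := ν)]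
    have hy : (y : Euc (k + 1)) ≠ 0 := y.2
    exact (((contDiffAt_norm ℝ hy).inv (norm_ne_zero_iff.2 hy)).smul contDiffAt_id).contMDiffAt
  have := Fact.mk (finrank_euclideanSpace_fin (𝕜 := ℝ) (n := k + 1))
  have h2 := hf.comp (h1.codRestrict_sphere hν)
  have h3 : (f ∘ codRestrict (fun y : U => ν y) _ hν) = fun y : U => radialExt f y := by
    funext y
    exact (radialExt_of_ne f y.2).symm
  rw [h3] at h2
  have h4 := contMDiffAt_subtype_iff.1 (h2 ⟨x, hx⟩)
  exact contMDiffAt_iff_contDiffAt.1 h4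

theorem fderiv_radialExt_smul {k N : ℕ} (f : Sph k → Euc N) {c : ℝ} (hc : 0 < c)
    (x : Euc (k + 1)) : c • fderiv ℝ (radialExt f) (c • x) = fderiv ℝ (radialExt f) x := by
  rw [← fderiv_comp_smul]
  simp_rw [radialExt_smul f hc]

theorem continuous_sphereDensity_spherePullback {k N : ℕ} {f : Sph k → Euc N}
    (hf : ContMDiff (𝓡 k) 𝓘(ℝ, Euc N) ((⊤ : ℕ∞) : WithTop ℕ∞) f) {ω : DForm N k}
    (hω : ContDiff ℝ ((⊤ : ℕ∞) : WithTop ℕ∞) ω) :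
    Continuous fun x : Sph k => sphereDensity x (spherePullback f ω x) := by
  have h1 : Continuous fun x : Sph k => spherePullback f ω x := by
    rw [continuous_iff_continuousAt]
    intro x
    have hx : (x : Euc (k + 1)) ≠ 0 := ne_zero_of_mem_unit_sphere x
    have hF := contDiffAt_radialExt hf hx
    have h : ContDiffAt ℝ ((⊤ : ℕ∞) : WithTop ℕ∞) (fun y : Euc (k + 1) =>
        (ω (radialExt f y)).compContinuousLinearMap (fderiv ℝ (radialExt f) y)) x :=
      (hω.contDiffAt.comp _ hF).alternating_compContinuousLinearMap
        (hF.fderiv_right (by simp))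
    have h' := ContinuousAt.comp (f := ((↑) : Sph k → Euc (k + 1))) h.continuousAt
      continuous_subtype_val.continuousAt
    refine h'.congr (.of_forall fun y => ?_)
    simp [spherePullback, radialExt_coe]
  unfold sphereDensity
  refine continuous_finsetSum _ fun i _ => ?_
  have h2 : Continuous fun x : Sph k => (x : Euc (k + 1)) i :=
    (EuclideanSpace.proj (𝕜 := ℝ) i).continuous.comp continuous_subtype_val
  have h3 : Continuous fun x : Sph k => spherePullback f ω x
      (fun j => EuclideanSpace.single (i.succAbove j) (1 : ℝ)) :=
    (ContinuousAlternatingMap.apply ℝ (Euc (k + 1)) ℝ _).continuous.comp h1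
  exact (continuous_const.mul h2).mul h3

theorem sphereIntegral_add {k N : ℕ} {f : Sph k → Euc N}
    (hf : ContMDiff (𝓡 k) 𝓘(ℝ, Euc N) ((⊤ : ℕ∞) : WithTop ℕ∞) f) {ω ω' : DForm N k}
    (hω : ContDiff ℝ ((⊤ : ℕ∞) : WithTop ℕ∞) ω) (hω' : ContDiff ℝ ((⊤ : ℕ∞) : WithTop ℕ∞) ω') :
    sphereIntegral f (ω + ω') = sphereIntegral f ω + sphereIntegral f ω' := by
  unfold sphereIntegral
  rw [← integral_add]
  · refine integral_congr_ae (.of_forall fun x => ?_)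
    simp [sphereDensity, spherePullback, mul_add, Finset.sum_add_distrib]
  · exact (continuous_sphereDensity_spherePullback hf hω).integrable_of_hasCompactSupport
      (HasCompactSupport.of_compactSpace _)
  · exact (continuous_sphereDensity_spherePullback hf hω').integrable_of_hasCompactSupport
      (HasCompactSupport.of_compactSpace _)

/-- Integration in polar coordinates. With `F = radialExt f`, the sum is the `(k+1)`-form
`h(|x|) d|x| ∧ F^* ω` evaluated on the standard basis, and its integral over `ℝᵏ⁺¹` is
`(∫ h) · ∫_{𝕊ᵏ} f^* ω`: the form `F^* ω` is homogeneous of degree `-k`, which cancels the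
Jacobian `r^k`. -/
theorem integral_radial_wedge_pullback {k N : ℕ} (f : Sph k → Euc N) (ω : DForm N k) (h : ℝ → ℝ) :
    ∫ x : Euc (k + 1), ∑ i : Fin (k + 1), (-1 : ℝ) ^ (i : ℕ) * (h ‖x‖ * (‖x‖⁻¹ * x i)) *
      (ω (radialExt f x)).compContinuousLinearMap (fderiv ℝ (radialExt f) x)
        (fun j => EuclideanSpace.single (i.succAbove j) (1 : ℝ)) =
      (∫ r in Ioi (0 : ℝ), h r) * sphereIntegral f ω := by
  set G : Euc (k + 1) → ℝ := fun x => ∑ i : Fin (k + 1), (-1 : ℝ) ^ (i : ℕ) *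
    (h ‖x‖ * (‖x‖⁻¹ * x i)) *
      (ω (radialExt f x)).compContinuousLinearMap (fderiv ℝ (radialExt f) x)
        (fun j => EuclideanSpace.single (i.succAbove j) (1 : ℝ)) with hG
  have key : ∀ x : ({0}ᶜ : Set (Euc (k + 1))), G x =
      sphereDensity (homeomorphUnitSphereProd _ x).1
        (spherePullback f ω (homeomorphUnitSphereProd _ x).1) *
        ((homeomorphUnitSphereProd _ x).2.1⁻¹ ^ k * h (homeomorphUnitSphereProd _ x).2.1) := by
    intro x
    have hx : (x : Euc (k + 1)) ≠ 0 := x.2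
    have hx' : 0 < ‖(x : Euc (k + 1))‖ := norm_pos_iff.2 hx
    have hD := fderiv_radialExt_smul f (inv_pos.2 hx') (x : Euc (k + 1))
    have hF := radialExt_smul f (inv_pos.2 hx') (x : Euc (k + 1))
    simp only [hG, sphereDensity, spherePullback, homeomorphUnitSphereProd_apply_snd_coe,
      homeomorphUnitSphereProd_apply_fst_coe, Finset.sum_mul]
    refine Finset.sum_congr rfl fun i _ => ?_
    rw [← hD, ← hF, ← radialExt_coe f, homeomorphUnitSphereProd_apply_fst_coe]
    simp only [ContinuousAlternatingMap.compContinuousLinearMap_apply, Function.comp_def,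
      smul_apply, PiLp.smul_apply, smul_eq_mul]
    rw [ContinuousAlternatingMap.map_smul_univ (ω (radialExt f (‖(x : Euc (k + 1))‖⁻¹ • x.1)))
      (fun _ : Fin k => ‖(x : Euc (k + 1))‖⁻¹)]
    simp only [Finset.prod_const, Finset.card_univ, Fintype.card_fin, smul_eq_mul]
    ring
  calc ∫ x, G x = ∫ x : ({0}ᶜ : Set (Euc (k + 1))), G x ∂(volume.comap Subtype.val) := by
        rw [integral_subtype_comap (measurableSet_singleton _).compl, restrict_compl_singleton]
    _ = ∫ z, sphereDensity z.1 (spherePullback f ω z.1) * (z.2.1⁻¹ ^ k * h z.2.1)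
          ∂(volume.toSphere.prod (.volumeIoiPow (Module.finrank ℝ (Euc (k + 1)) - 1))) := by
        simp_rw [key]
        exact (Measure.measurePreserving_homeomorphUnitSphereProd
          (volume : Measure (Euc (k + 1)))).integral_comp (Homeomorph.measurableEmbedding _)
          (fun z => sphereDensity z.1 (spherePullback f ω z.1) * (z.2.1⁻¹ ^ k * h z.2.1))
    _ = sphereIntegral f ω * ∫ r : Ioi (0 : ℝ), r.1⁻¹ ^ k * h r.1
          ∂(.volumeIoiPow (Module.finrank ℝ (Euc (k + 1)) - 1)) :=
        integral_prod_mul (fun x => sphereDensity x (spherePullback f ω x))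
          (fun r : Ioi (0 : ℝ) => r.1⁻¹ ^ k * h r.1)
    _ = _ := by
        rw [mul_comm]
        congr 1
        have hdim : Module.finrank ℝ (Euc (k + 1)) - 1 = k := by simp
        rw [hdim]
        simp only [Measure.volumeIoiPow, ENNReal.ofReal]
        rw [integral_withDensity_eq_integral_smul
          ((measurable_subtype_coe.pow_const _).real_toNNReal),
          integral_subtype_comap measurableSet_Ioi
            (fun r : ℝ => Real.toNNReal (r ^ k) • (r⁻¹ ^ k * h r))]
        refine setIntegral_congr_fun measurableSet_Ioi fun r hr => ?_
        have hr' : (0 : ℝ) < r := hr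
        simp only [NNReal.smul_def, Real.coe_toNNReal _ (pow_nonneg hr'.le k), smul_eq_mul]
        rw [← mul_assoc, ← mul_pow, mul_inv_cancel₀ hr'.ne', one_pow, one_mul]

/-! ### Homotopy invariance of the integral over the sphere -/

theorem single_removeNth {k : ℕ} (i : Fin (k + 1)) :
    i.removeNth (fun j : Fin (k + 1) => (EuclideanSpace.single j (1 : ℝ) : Euc (k + 1))) =
      fun j => EuclideanSpace.single (i.succAbove j) (1 : ℝ) := rfl

theorem fderiv_comp_norm_single {n : ℕ} {p : ℝ → ℝ} {x : Euc n} (hx : x ≠ 0)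
    (hp : DifferentiableAt ℝ p ‖x‖) (i : Fin n) :
    fderiv ℝ (fun y : Euc n => p ‖y‖) x (EuclideanSpace.single i (1 : ℝ)) =
      deriv p ‖x‖ * (‖x‖⁻¹ * x i) := by
  have hN := ((contDiffAt_norm (n := 1) ℝ hx).differentiableAt one_ne_zero).hasFDerivAt
  have hsq : (‖x‖ ^ 1 * 2) * fderiv ℝ norm x (EuclideanSpace.single i (1 : ℝ)) = 2 * x i := by
    have h := congrArg (fun D : Euc n →L[ℝ] ℝ => D (EuclideanSpace.single i (1 : ℝ)))
      ((hN.pow 2).unique (hasStrictFDerivAt_norm_sq x).hasFDerivAt)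
    simpa [EuclideanSpace.inner_single_right, mul_comm] using h
  have h2 : (fun y : Euc n => p ‖y‖) = p ∘ norm := rfl
  rw [h2, (hp.hasDerivAt.comp_hasFDerivAt x hN).fderiv, smul_apply, smul_eq_mul]
  congr 1
  have := norm_ne_zero_iff.2 hx
  field_simp
  linarith

theorem contDiff_smoothTransition_sub (a : ℝ) :
    ContDiff ℝ ((⊤ : ℕ∞) : WithTop ℕ∞) fun r => Real.smoothTransition (r - a) :=
  Real.smoothTransition.contDiff.comp (contDiff_id.sub contDiff_const)

theorem contDiff_smoothTransition_norm_sub {n : ℕ} {a : ℝ} (ha : 0 < a) :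
    ContDiff ℝ ((⊤ : ℕ∞) : WithTop ℕ∞) fun x : Euc n => Real.smoothTransition (‖x‖ - a) := by
  refine contDiff_iff_contDiffAt.2 fun x => ?_
  by_cases hx : x = 0
  · refine (contDiffAt_const (c := 0)).congr_of_eventuallyEq ?_
    have : ∀ᶠ y : Euc n in 𝓝 x, ‖y‖ < a :=
      (isOpen_lt continuous_norm continuous_const).mem_nhds (by simpa [hx] using ha)
    filter_upwards [this] with y hy
    exact Real.smoothTransition.zero_of_nonpos (by linarith)
  · exact (contDiff_smoothTransition_sub a).contDiffAt.comp x (contDiffAt_norm ℝ hx)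

theorem deriv_smoothTransition_sub_eq_zero {a r : ℝ} (h : r ≤ a ∨ a + 1 ≤ r) :
    deriv (fun r => Real.smoothTransition (r - a)) r = 0 := by
  rcases h with h | h
  · refine IsLocalMin.deriv_eq_zero (.of_forall fun y => ?_)
    beta_reduce
    rw [Real.smoothTransition.zero_of_nonpos (by linarith : r - a ≤ 0)]
    exact Real.smoothTransition.nonneg _
  · refine IsLocalMax.deriv_eq_zero (.of_forall fun y => ?_)
    beta_reduce
    rw [Real.smoothTransition.one_of_one_le (by linarith : 1 ≤ r - a)]
    exact Real.smoothTransition.le_one _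

theorem integral_deriv_smoothTransition_sub {a : ℝ} (ha : 0 ≤ a) :
    ∫ r in Ioi (0 : ℝ), deriv (fun r => Real.smoothTransition (r - a)) r = 1 := by
  have hmono : Monotone (fun r => Real.smoothTransition (r - a)) := fun r s hrs =>
    Real.smoothTransition.monotone (by linarith)
  have hlim : Tendsto (fun r => Real.smoothTransition (r - a)) atTop (𝓝 1) := by
    refine tendsto_const_nhds.congr' ?_
    filter_upwards [eventually_ge_atTop (a + 1)] with r hr
    rw [Real.smoothTransition.one_of_one_le (by linarith)]
  rw [integral_Ioi_of_hasDerivAt_of_nonneg' (fun r _ =>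
    ((contDiff_smoothTransition_sub a).differentiable (by simp) r).hasDerivAt)
    (fun r _ => hmono.deriv_nonneg) hlim,
    Real.smoothTransition.zero_of_nonpos (show 0 - a ≤ 0 by linarith), sub_zero]

theorem fderiv_smoothTransition_norm_single {n : ℕ} {x : Euc n} (hx : x ≠ 0) (a : ℝ) (i : Fin n) :
    fderiv ℝ (fun y : Euc n => Real.smoothTransition (‖y‖ - a)) x
      (EuclideanSpace.single i (1 : ℝ)) =
      deriv (fun r => Real.smoothTransition (r - a)) ‖x‖ * (‖x‖⁻¹ * x i) :=
  fderiv_comp_norm_single (p := fun r => Real.smoothTransition (r - a)) hx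
    ((contDiff_smoothTransition_sub a).differentiable (by simp) _) i

/-- Homotopy invariance: if `ω` is closed along the segments from `f x` to `g x`, then
`∫ f^* ω = ∫ g^* ω`. The straight-line homotopy is spread over the annulus `1 ≤ |x| ≤ 4`: the map
`H` is the radial extension of `f` for `|x| ≤ 2` and that of `g` for `|x| ≥ 3`. The cutoff `u` rises
from `0` to `1` on `[1, 2]` and falls back to `0` on `[3, 4]`, so that `∫ du ∧ H^* ω = 0` says
that the difference of the two integrals vanishes. -/
theorem sphereIntegral_eq_of_closed_segment {k N : ℕ} {f g : Sph k → Euc N}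
    (hf : ContMDiff (𝓡 k) 𝓘(ℝ, Euc N) ((⊤ : ℕ∞) : WithTop ℕ∞) f)
    (hg : ContMDiff (𝓡 k) 𝓘(ℝ, Euc N) ((⊤ : ℕ∞) : WithTop ℕ∞) g) {ω : DForm N k}
    (hω : ContDiff ℝ ((⊤ : ℕ∞) : WithTop ℕ∞) ω)
    (hd : ∀ x, ∀ t ∈ Icc (0 : ℝ) 1, extDeriv ω (f x + t • (g x - f x)) = 0) :
    sphereIntegral f ω = sphereIntegral g ω := by
  let T := Real.smoothTransition
  have hT0 : ∀ a r : ℝ, r ≤ a → T (r - a) = 0 := fun a r h =>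
    Real.smoothTransition.zero_of_nonpos (by linarith)
  have hT1 : ∀ a r : ℝ, a + 1 ≤ r → T (r - a) = 1 := fun a r h =>
    Real.smoothTransition.one_of_one_le (by linarith)
  let u : Euc (k + 1) → ℝ := fun x => T (‖x‖ - 1) - T (‖x‖ - 3)
  let H : Euc (k + 1) → Euc N := fun x =>
    radialExt f x + T (‖x‖ - 2) • (radialExt g x - radialExt f x)
  let β : DForm (k + 1) k := fun x => (ω (H x)).compContinuousLinearMap (fderiv ℝ H x)
  have hsupp : tsupport u ⊆ {x | 1 ≤ ‖x‖ ∧ ‖x‖ ≤ 4} := by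
    refine closure_minimal (fun x hx => ?_)
      ((isClosed_le continuous_const continuous_norm).inter
        (isClosed_le continuous_norm continuous_const))
    refine ⟨?_, ?_⟩ <;> by_contra! h <;> refine hx ?_ <;> simp only [u]
    · rw [hT0 _ _ h.le, hT0 _ _ (by linarith), sub_zero]
    · rw [hT1 _ _ (by linarith), hT1 _ _ (by linarith), sub_self]
  have hc : HasCompactSupport u := (isCompact_closedBall (0 : Euc (k + 1)) 4).of_isClosed_subset
    (isClosed_tsupport u) fun x hx => by simpa using (hsupp hx).2
  have hne : ∀ x ∈ tsupport u, x ≠ 0 := fun x hx h0 => by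
    have := (hsupp hx).1
    rw [h0, norm_zero] at this
    linarith
  have hpd : Differentiable ℝ fun x : Euc (k + 1) => T (‖x‖ - 1) :=
    (contDiff_smoothTransition_norm_sub one_pos).differentiable (by simp)
  have hqd : Differentiable ℝ fun x : Euc (k + 1) => T (‖x‖ - 3) :=
    (contDiff_smoothTransition_norm_sub three_pos).differentiable (by simp)
  have hu : ContDiff ℝ 1 u := ((contDiff_smoothTransition_norm_sub one_pos).sub
    (contDiff_smoothTransition_norm_sub three_pos)).of_le (by norm_cast)
  have hH : ∀ x, x ≠ 0 → ContDiffAt ℝ ((⊤ : ℕ∞) : WithTop ℕ∞) H x := fun x hx =>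
    (contDiffAt_radialExt hf hx).add
      ((contDiff_smoothTransition_norm_sub two_pos).contDiffAt.smul
        ((contDiffAt_radialExt hg hx).sub (contDiffAt_radialExt hf hx)))
  have hβ : ∀ x ∈ tsupport u, ContDiffAt ℝ 1 β x := fun x hx => by
    refine ContDiffAt.of_le (n := ((⊤ : ℕ∞) : WithTop ℕ∞)) ?_ (by norm_cast)
    exact (hω.contDiffAt.comp x (hH x (hne x hx))).alternating_compContinuousLinearMap
      ((hH x (hne x hx)).fderiv_right (by simp))
  have hβd : ∀ x ∈ tsupport u, extDeriv β x = 0 := fun x hx => by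
    have hx0 := hne x hx
    have : extDeriv ω (H x) = 0 := by
      simp only [H]
      rw [radialExt_of_ne f hx0, radialExt_of_ne g hx0]
      exact hd _ _ ⟨Real.smoothTransition.nonneg _, Real.smoothTransition.le_one _⟩
    rw [show β = fun x => (ω (H x)).compContinuousLinearMap (fderiv ℝ H x) from rfl,
      extDeriv_pullback (hω.differentiable (by simp) _) (hH x hx0)
        (by rw [minSmoothness_of_isRCLikeNormedField]; norm_cast), this]
    ext v
    simp
  obtain ⟨hint, hstokes⟩ := integrable_wedge_and_integral_eq_zero hu hc hβ hβd
    (fun j : Fin (k + 1) => (EuclideanSpace.single j (1 : ℝ) : Euc (k + 1)))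
  set Z : Euc (k + 1) → ℝ := fun x => ∑ i : Fin (k + 1), (-1 : ℝ) ^ (i : ℕ) *
    fderiv ℝ u x (EuclideanSpace.single i (1 : ℝ)) *
      β x (i.removeNth fun j => EuclideanSpace.single j (1 : ℝ)) with hZ
  have hu' : ∀ x ≠ 0, ∀ i, fderiv ℝ u x (EuclideanSpace.single i (1 : ℝ)) =
      deriv (fun r => T (r - 1)) ‖x‖ * (‖x‖⁻¹ * x i) -
        deriv (fun r => T (r - 3)) ‖x‖ * (‖x‖⁻¹ * x i) := fun x hx i => by
    rw [show u = fun x => T (‖x‖ - 1) - T (‖x‖ - 3) from rfl, fderiv_fun_sub (hpd x) (hqd x),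
      sub_apply, fderiv_smoothTransition_norm_single hx, fderiv_smoothTransition_norm_single hx]
  have hβf : ∀ x : Euc (k + 1), ‖x‖ < 2 →
      β x = (ω (radialExt f x)).compContinuousLinearMap (fderiv ℝ (radialExt f) x) := by
    intro x hx
    have h : H =ᶠ[𝓝 x] radialExt f := by
      filter_upwards [(isOpen_lt continuous_norm continuous_const).mem_nhds hx] with y hy
      simp only [H]
      rw [hT0 _ _ (le_of_lt hy), zero_smul, add_zero]
    simp only [β]
    rw [h.fderiv_eq, h.eq_of_nhds]
  have hβg : ∀ x : Euc (k + 1), 3 < ‖x‖ →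
      β x = (ω (radialExt g x)).compContinuousLinearMap (fderiv ℝ (radialExt g) x) := by
    intro x hx
    have h : H =ᶠ[𝓝 x] radialExt g := by
      filter_upwards [(isOpen_lt continuous_const continuous_norm).mem_nhds hx] with y hy
      have hy' : 3 < ‖y‖ := hy
      simp only [H]
      rw [hT1 _ _ (by linarith), one_smul, add_sub_cancel]
    simp only [β]
    rw [h.fderiv_eq, h.eq_of_nhds]
  have hS : MeasurableSet {x : Euc (k + 1) | ‖x‖ < 2} :=
    measurableSet_lt measurable_norm measurable_const
  have hae : ∀ᵐ x : Euc (k + 1), x ≠ 0 := by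
    simp [ae_iff, measure_singleton]
  -- The sphere `|x| = 2` separates the supports of the two parts of `du`.
  have hA : ∫ x in {x : Euc (k + 1) | ‖x‖ < 2}, Z x = sphereIntegral f ω := by
    rw [← one_mul (sphereIntegral f ω), ← integral_deriv_smoothTransition_sub zero_le_one,
      ← integral_radial_wedge_pullback, ← integral_indicator hS]
    refine integral_congr_ae ?_
    filter_upwards [hae] with x hx
    by_cases hx2 : ‖x‖ < 2
    · rw [indicator_of_mem (by exact hx2)]
      refine Finset.sum_congr rfl fun i _ => ?_
      rw [hu' x hx, hβf x hx2, deriv_smoothTransition_sub_eq_zero (a := 3) (.inl (by linarith))]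
      rw [zero_mul, sub_zero]
      rfl
    · rw [indicator_of_notMem (by exact hx2), deriv_smoothTransition_sub_eq_zero
        (.inr (by linarith))]
      simp
  have hB : ∫ x in {x : Euc (k + 1) | ‖x‖ < 2}ᶜ, Z x = - sphereIntegral g ω := by
    rw [← one_mul (sphereIntegral g ω),
      ← integral_deriv_smoothTransition_sub (zero_le_three),
      ← integral_radial_wedge_pullback, ← integral_indicator hS.compl, ← integral_neg]
    refine integral_congr_ae ?_
    filter_upwards [hae] with x hx
    by_cases hx2 : ‖x‖ < 2
    · rw [indicator_of_notMem (by simpa using hx2), deriv_smoothTransition_sub_eq_zero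
        (.inl (by linarith))]
      simp
    · rw [indicator_of_mem (by simpa using hx2), ← Finset.sum_neg_distrib]
      refine Finset.sum_congr rfl fun i _ => ?_
      rw [hu' x hx, deriv_smoothTransition_sub_eq_zero (a := 1) (.inr (by linarith))]
      by_cases hx3 : ‖x‖ ≤ 3
      · rw [deriv_smoothTransition_sub_eq_zero (.inl hx3)]
        simp
      · rw [hβg x (not_le.1 hx3), single_removeNth]
        ring
  have := integral_add_compl hS hint
  rw [hstokes, hA, hB] at this
  linarith

/-- The pullback by a constant map is a constant form (zero unless `k = 0`), so its integral
vanishes by Stokes' theorem with a cutoff equal to `1` near the origin; for `k = 0` this is the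
cancellation between the two points of `𝕊⁰`. -/
theorem sphereIntegral_const {k N : ℕ} (c : Euc N) (ω : DForm N k) :
    sphereIntegral (fun _ => c) ω = 0 := by
  let T := Real.smoothTransition
  let u : Euc (k + 1) → ℝ := fun x => 1 - T (‖x‖ - 1)
  let α : (Euc (k + 1)) [⋀^Fin k]→L[ℝ] ℝ := (ω c).compContinuousLinearMap 0
  have hc : HasCompactSupport u := by
    refine HasCompactSupport.intro (isCompact_closedBall (0 : Euc (k + 1)) 2) fun x hx => ?_
    have hx : 2 < ‖x‖ := by simpa using hx
    simp only [u]
    rw [show T (‖x‖ - 1) = 1 from Real.smoothTransition.one_of_one_le (by linarith), sub_self]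
  have hpd : ContDiff ℝ ((⊤ : ℕ∞) : WithTop ℕ∞) fun x : Euc (k + 1) => T (‖x‖ - 1) :=
    contDiff_smoothTransition_norm_sub one_pos
  have hstokes := (integrable_wedge_and_integral_eq_zero (β := fun _ => α)
    ((contDiff_const.sub hpd).of_le (by norm_cast)) hc (fun _ _ => contDiffAt_const)
    (fun x _ => by
      ext v
      rw [extDeriv_apply (differentiableAt_const _)]
      simp)
    (fun j : Fin (k + 1) => (EuclideanSpace.single j (1 : ℝ) : Euc (k + 1)))).2
  rw [← one_mul (sphereIntegral _ ω), ← integral_deriv_smoothTransition_sub zero_le_one,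
    ← integral_radial_wedge_pullback, ← neg_eq_zero, ← integral_neg, ← hstokes]
  refine integral_congr_ae ?_
  have hae : ∀ᵐ x : Euc (k + 1), x ≠ 0 := by
    simp [ae_iff, measure_singleton]
  filter_upwards [hae] with x hx
  have h : radialExt (fun _ : Sph k => c) =ᶠ[𝓝 x] fun _ => c := by
    filter_upwards [isOpen_ne.mem_nhds hx] with y hy
    exact radialExt_of_ne _ hy
  rw [← Finset.sum_neg_distrib]
  refine Finset.sum_congr rfl fun i _ => ?_
  rw [fderiv_const_sub, h.fderiv_eq, h.eq_of_nhds,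
    neg_apply, fderiv_smoothTransition_norm_single hx, single_removeNth]
  simp [α]

/-- A closed form on `ℝᴺ` has integral zero over every smooth sphere, because the sphere contracts
to a point in `ℝᴺ`. -/
theorem sphereIntegral_eq_zero_of_extDeriv_eq_zero {k N : ℕ} {f : Sph k → Euc N}
    (hf : ContMDiff (𝓡 k) 𝓘(ℝ, Euc N) ((⊤ : ℕ∞) : WithTop ℕ∞) f) {ω : DForm N k}
    (hω : ContDiff ℝ ((⊤ : ℕ∞) : WithTop ℕ∞) ω) (hd : extDeriv ω = 0) :
    sphereIntegral f ω = 0 := by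
  rw [sphereIntegral_eq_of_closed_segment hf contMDiff_const hω (fun x t _ => congrFun hd _),
    sphereIntegral_const 0 ω]

theorem sphereIntegral_eq_of_extDeriv_eq {k N : ℕ} {f : Sph k → Euc N}
    (hf : ContMDiff (𝓡 k) 𝓘(ℝ, Euc N) ((⊤ : ℕ∞) : WithTop ℕ∞) f) {ω ω' : DForm N k}
    (hω : ContDiff ℝ ((⊤ : ℕ∞) : WithTop ℕ∞) ω) (hω' : ContDiff ℝ ((⊤ : ℕ∞) : WithTop ℕ∞) ω')
    (hd : extDeriv ω' = extDeriv ω) : sphereIntegral f ω' = sphereIntegral f ω := by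
  obtain ⟨ξ, rfl⟩ : ∃ ξ : DForm N k, ω' = ω + ξ := ⟨ω' - ω, (add_sub_cancel ω ω').symm⟩
  have hξ : ContDiff ℝ ((⊤ : ℕ∞) : WithTop ℕ∞) ξ := by
    have h : ξ = fun y => (ω + ξ) y - ω y := funext fun y => (add_sub_cancel_left _ _).symm
    rw [h]
    exact hω'.sub hω
  have hdξ : extDeriv ξ = 0 := funext fun y => by
    have h := extDeriv_add (hω.differentiable (by simp) y) (hξ.differentiable (by simp) y)
    rw [hd] at h
    exact left_eq_add.1 h
  rw [sphereIntegral_add hf hω hξ, sphereIntegral_eq_zero_of_extDeriv_eq_zero hf hξ hdξ, add_zero]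

/-! ### Pullback of forms -/

/-- The pullback `G^* ω` of a form on `ℝᴹ` by a map `G : ℝᴺ → ℝᴹ`. -/
noncomputable def DForm.pullback {N M k : ℕ} (G : Euc N → Euc M) (ω : DForm M k) : DForm N k :=
  fun y => (ω (G y)).compContinuousLinearMap (fderiv ℝ G y)

theorem DForm.contDiff_pullback {N M k : ℕ} {G : Euc N → Euc M} {ω : DForm M k}
    (hG : ContDiff ℝ ((⊤ : ℕ∞) : WithTop ℕ∞) G) (hω : ContDiff ℝ ((⊤ : ℕ∞) : WithTop ℕ∞) ω) :
    ContDiff ℝ ((⊤ : ℕ∞) : WithTop ℕ∞) (DForm.pullback G ω) :=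
  contDiff_iff_contDiffAt.2 fun _ =>
    (hω.comp hG).contDiffAt.alternating_compContinuousLinearMap
      (hG.contDiffAt.fderiv_right (by simp))

theorem sphereIntegral_pullback {k N M : ℕ} {f : Sph k → Euc N} {G : Euc N → Euc M}
    (hf : ContMDiff (𝓡 k) 𝓘(ℝ, Euc N) ((⊤ : ℕ∞) : WithTop ℕ∞) f)
    (hG : ContDiff ℝ ((⊤ : ℕ∞) : WithTop ℕ∞) G) (ω : DForm M k) :
    sphereIntegral f (DForm.pullback G ω) = sphereIntegral (fun x => G (f x)) ω := by
  unfold sphereIntegral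
  congr 1
  funext x
  congr 1
  have hx : (x : Euc (k + 1)) ≠ 0 := ne_zero_of_mem_unit_sphere x
  have h : radialExt (fun x => G (f x)) =ᶠ[𝓝 (x : Euc (k + 1))] G ∘ radialExt f := by
    filter_upwards [isOpen_ne.mem_nhds hx] with y hy
    simp [radialExt_of_ne _ hy]
  have hF := (contDiffAt_radialExt hf hx).differentiableAt (by simp)
  ext v
  simp only [spherePullback, DForm.pullback,
    ContinuousAlternatingMap.compContinuousLinearMap_apply]
  rw [h.fderiv_eq, fderiv_comp _ (hG.differentiable (by simp) _) hF, radialExt_coe]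
  rfl

/-! ### The solid angle form -/

/-- The pullback of a top-degree form by a singular linear map vanishes. -/
theorem ContinuousAlternatingMap.compContinuousLinearMap_eq_zero_of_apply_eq_zero {k : ℕ}
    {α : (Euc (k + 1)) [⋀^Fin (k + 1)]→L[ℝ] ℝ} {A : Euc (k + 1) →L[ℝ] Euc (k + 1)}
    {y : Euc (k + 1)} (hy : y ≠ 0) (hA : A y = 0) : α.compContinuousLinearMap A = 0 := by
  ext v
  refine AlternatingMap.map_linearDependent α.toAlternatingMap (fun i => A (v i)) fun hli => hy ?_
  have hspan := hli.span_eq_top_of_card_eq_finrank (by simp)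
  have hsurj : Function.Surjective (A : Euc (k + 1) →ₗ[ℝ] Euc (k + 1)) := by
    rw [← LinearMap.range_eq_top, eq_top_iff, ← hspan, Submodule.span_le]
    rintro _ ⟨i, rfl⟩
    exact ⟨v i, rfl⟩
  exact LinearMap.injective_iff_surjective.2 hsurj (by simpa using hA)

theorem fderiv_radialExt_self {k N : ℕ} {f : Sph k → Euc N} {y : Euc (k + 1)}
    (hf : DifferentiableAt ℝ (radialExt f) y) : fderiv ℝ (radialExt f) y y = 0 := by
  rw [← hf.lineDeriv_eq_fderiv, lineDeriv]
  have h : (fun t : ℝ => radialExt f (y + t • y)) =ᶠ[𝓝 0] fun _ => radialExt f y := by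
    filter_upwards [isOpen_Ioi.mem_nhds (show (0 : ℝ) ∈ Ioi (-1) by simp)] with t ht
    have ht : -1 < t := ht
    rw [show y + t • y = (1 + t) • y by rw [add_smul, one_smul],
      radialExt_smul f (by linarith)]
  rw [h.deriv_eq, deriv_const]

/-- The smooth map `ℝᵏ⁺¹ → ℝᵏ⁺¹` that agrees with `y ↦ y / |y|` for `|y| ≥ 2` and vanishes for
`|y| ≤ 1`. -/
noncomputable def smoothDir (k : ℕ) (y : Euc (k + 1)) : Euc (k + 1) :=
  Real.smoothTransition (‖y‖ - 1) • radialExt ((↑) : Sph k → Euc (k + 1)) y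

theorem contDiff_smoothDir (k : ℕ) : ContDiff ℝ ((⊤ : ℕ∞) : WithTop ℕ∞) (smoothDir k) := by
  refine contDiff_iff_contDiffAt.2 fun x => ?_
  by_cases hx : x = 0
  · refine (contDiffAt_const (c := 0)).congr_of_eventuallyEq ?_
    have : ∀ᶠ y : Euc (k + 1) in 𝓝 x, ‖y‖ < 1 :=
      (isOpen_lt continuous_norm continuous_const).mem_nhds (by simp [hx])
    filter_upwards [this] with y hy
    rw [smoothDir, Real.smoothTransition.zero_of_nonpos (by linarith), zero_smul]
  · exact (contDiff_smoothTransition_norm_sub one_pos).contDiffAt.smul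
      (contDiffAt_radialExt (contMDiff_coe_sph k) hx)

theorem smoothDir_eq {k : ℕ} {y : Euc (k + 1)} (hy : 2 ≤ ‖y‖) :
    smoothDir k y = radialExt ((↑) : Sph k → Euc (k + 1)) y := by
  rw [smoothDir, Real.smoothTransition.one_of_one_le (by linarith), one_smul]

/-- Forms of degree `k` pulled back by `y ↦ y / |y|` are closed: their exterior derivative is the
pullback of a top-degree form by a map whose differential kills the radial direction. -/
theorem extDeriv_pullback_smoothDir {k : ℕ} {τ : DForm (k + 1) k}
    (hτ : ContDiff ℝ ((⊤ : ℕ∞) : WithTop ℕ∞) τ) {y : Euc (k + 1)} (hy : 2 < ‖y‖) :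
    extDeriv (DForm.pullback (smoothDir k) τ) y = 0 := by
  have hy0 : y ≠ 0 := norm_pos_iff.1 (by linarith)
  have h : smoothDir k =ᶠ[𝓝 y] radialExt ((↑) : Sph k → Euc (k + 1)) := by
    filter_upwards [(isOpen_lt continuous_const continuous_norm).mem_nhds hy] with z hz
    exact smoothDir_eq (le_of_lt hz)
  unfold DForm.pullback
  rw [extDeriv_pullback (hτ.differentiable (by simp) _) (contDiff_smoothDir k).contDiffAt
    (by rw [minSmoothness_of_isRCLikeNormedField]; norm_cast), h.fderiv_eq]
  exact ContinuousAlternatingMap.compContinuousLinearMap_eq_zero_of_apply_eq_zero hy0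
    (fderiv_radialExt_self
      ((contDiffAt_radialExt (contMDiff_coe_sph k) hy0).differentiableAt (by simp)))

/-- The standard volume form of `ℝⁿ`: the determinant of the matrix whose rows are the given
vectors. -/
noncomputable def volForm (n : ℕ) : (Euc n) [⋀^Fin n]→L[ℝ] ℝ :=
  { Matrix.detRowAlternating.compLinearMap
      ((EuclideanSpace.equiv (Fin n) ℝ).toLinearEquiv : Euc n →ₗ[ℝ] Fin n → ℝ) with
    cont := by
      change Continuous fun v : Fin n → Euc n => Matrix.det (Matrix.of fun j i => v j i)
      refine Continuous.matrix_det (continuous_matrix fun j i => ?_)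
      exact (EuclideanSpace.proj (𝕜 := ℝ) i).continuous.comp (continuous_apply j) }

theorem volForm_apply {n : ℕ} (v : Fin n → Euc n) :
    volForm n v = Matrix.det (Matrix.of fun j i => v j i) := rfl

theorem volForm_cons_add_smul {k : ℕ} (x : Euc (k + 1)) (w : Fin k → Euc (k + 1)) (c : Fin k → ℝ) :
    volForm (k + 1) (Matrix.vecCons x fun j => w j + c j • x) =
      volForm (k + 1) (Matrix.vecCons x w) := by
  rw [volForm_apply, volForm_apply]
  refine Matrix.det_eq_of_forall_row_eq_smul_add_const (Matrix.vecCons 0 c) 0 rfl fun i j => ?_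
  refine Fin.cases ?_ (fun i => ?_) i <;> simp

/-- Contracting the volume form with `x` gives `∑ᵢ (-1)ⁱ xᵢ dx₀ ∧ ⋯ ∧ dx̂ᵢ ∧ ⋯ ∧ dx_k`. -/
theorem volForm_cons_single {k : ℕ} (x : Euc (k + 1)) (i : Fin (k + 1)) :
    volForm (k + 1) (Matrix.vecCons x fun j => EuclideanSpace.single (i.succAbove j) (1 : ℝ)) =
      (-1) ^ (i : ℕ) * x i := by
  rw [volForm_apply, Matrix.det_succ_row_zero, Finset.sum_eq_single i]
  · have h : (Matrix.of fun j l => (Matrix.vecCons x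
        (fun j => (EuclideanSpace.single (i.succAbove j) (1 : ℝ) : Euc (k + 1))) j) l).submatrix
        Fin.succ i.succAbove = 1 := by
      ext a b
      simp [Matrix.one_apply, eq_comm]
    rw [h]
    simp
  · intro l _ hl
    obtain ⟨a, ha⟩ := Fin.exists_succAbove_eq hl
    rw [Matrix.det_eq_zero_of_row_eq_zero a, mul_zero]
    intro c
    simp [ha, Fin.succAbove_ne]
  · simp

/-- The contraction of the volume form with the position vector restricts to the area form of the
sphere: its density is identically `1`, and its integral is the area of `𝕊ᵏ`. -/
theorem sphereIntegral_coe_volForm_pos (k : ℕ) :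
    0 < sphereIntegral ((↑) : Sph k → Euc (k + 1)) (fun y => (volForm (k + 1)).curryLeft y) := by
  have h1 : ∀ x : Sph k, sphereDensity x (spherePullback ((↑) : Sph k → Euc (k + 1))
      (fun y => (volForm (k + 1)).curryLeft y) x) = 1 := by
    intro x
    have hx : (x : Euc (k + 1)) ≠ 0 := ne_zero_of_mem_unit_sphere x
    have hn : ‖(x : Euc (k + 1))‖ = 1 := by simp
    have hF : radialExt ((↑) : Sph k → Euc (k + 1)) =ᶠ[𝓝 (x : Euc (k + 1))]
        fun y => ‖y‖⁻¹ • y := by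
      filter_upwards [isOpen_ne.mem_nhds hx] with y hy
      rw [radialExt_of_ne _ hy]
    have hD := (((contDiffAt_norm (n := 1) ℝ hx).inv (norm_ne_zero_iff.2 hx)).differentiableAt
      one_ne_zero).hasFDerivAt.fun_smul (hasFDerivAt_id (x : Euc (k + 1)))
    simp only [sphereDensity, spherePullback, hF.fderiv_eq,
      ContinuousAlternatingMap.compContinuousLinearMap_apply,
      ContinuousAlternatingMap.curryLeft_apply_apply, Function.comp_def]
    have hD' : fderiv ℝ (fun y : Euc (k + 1) => ‖y‖⁻¹ • y) x =
        ‖(x : Euc (k + 1))‖⁻¹ • ContinuousLinearMap.id ℝ (Euc (k + 1)) +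
          (fderiv ℝ norm⁻¹ (x : Euc (k + 1))).smulRight (x : Euc (k + 1)) := hD.fderiv
    rw [hD']
    simp only [add_apply, ContinuousLinearMap.id_apply,
      ContinuousLinearMap.smulRight_apply, hn, inv_one, one_smul]
    -- The differential of `y / |y|` at `x` is the identity modulo multiples of `x`.
    simp_rw [volForm_cons_add_smul, volForm_cons_single]
    have hsum : ∑ i, (x : Euc (k + 1)) i ^ 2 = 1 := by
      rw [← EuclideanSpace.real_norm_sq_eq, hn, one_pow]
    refine Eq.trans ?_ hsum
    refine Finset.sum_congr rfl fun i _ => ?_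
    have : ((-1 : ℝ) ^ (i : ℕ)) * (-1) ^ (i : ℕ) = 1 := by
      rw [← mul_pow]; simp
    linear_combination (x : Euc (k + 1)) i ^ 2 * this
  unfold sphereIntegral
  simp_rw [h1]
  rw [integral_const, smul_eq_mul, mul_one, Measure.toSphere_real_apply_univ]
  have : 0 < (volume : Measure (Euc (k + 1))).real (Metric.ball 0 1) :=
    ENNReal.toReal_pos (Metric.measure_ball_pos _ _ one_pos).ne' measure_ball_lt_top.ne
  have : 0 < (Module.finrank ℝ (Euc (k + 1)) : ℝ) := by simp; positivity
  positivity

/-! ### Smooth approximation of Hölder maps -/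

/-- A real `σ`-Hölder function on a subset extends with the same constant: it is Lipschitz for the
snowflake metric `dist ^ σ`, and real Lipschitz functions extend. -/
theorem exists_holder_extension {X : Type*} [PseudoMetricSpace X] {s : Set X} {f : s → ℝ}
    {C σ : ℝ≥0} (hσ0 : 0 < σ) (hσ1 : σ ≤ 1) (hf : HolderWith C σ f) :
    ∃ g : X → ℝ, (∀ x y, |g x - g y| ≤ C * dist x y ^ (σ : ℝ)) ∧ ∀ x : s, g x = f x := by
  classical
  have hσ0' : (0 : ℝ) < σ := hσ0
  have hσ1' : (σ : ℝ) ≤ 1 := hσ1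
  let Y := Metric.Snowflaking X σ hσ0' hσ1'
  let F : Y → ℝ := fun z => if h : z.ofSnowflaking ∈ s then f ⟨z.ofSnowflaking, h⟩ else 0
  have hF : LipschitzOnWith C F {z | z.ofSnowflaking ∈ s} := by
    refine LipschitzOnWith.of_dist_le_mul fun x hx y hy => ?_
    have hx : x.ofSnowflaking ∈ s := hx
    have hy : y.ofSnowflaking ∈ s := hy
    simp only [F, dif_pos hx, dif_pos hy]
    exact hf.dist_le _ _
  obtain ⟨g, hg, hgF⟩ := hF.extend_real
  refine ⟨fun x => g (Metric.Snowflaking.toSnowflaking x), fun x y => ?_, fun x => ?_⟩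
  · have := hg.dist_le_mul (Metric.Snowflaking.toSnowflaking x) (Metric.Snowflaking.toSnowflaking y)
    rwa [Metric.Snowflaking.dist_toSnowflaking_toSnowflaking, Real.dist_eq] at this
  · have hx : (Metric.Snowflaking.toSnowflaking (x : X) : Y).ofSnowflaking ∈ s := x.2
    exact (hgF hx).symm.trans (dif_pos hx)

/-- Mollification at scale `ε` moves a `σ`-Hölder function by at most `C ε ^ σ` and does not
increase its Hölder constant. -/
theorem exists_contDiff_holder_approx {n : ℕ} {f : Euc n → ℝ} {C σ : ℝ≥0} (hσ0 : 0 < σ)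
    (hf : ∀ x y, |f x - f y| ≤ C * dist x y ^ (σ : ℝ)) {ε : ℝ} (hε : 0 < ε) :
    ∃ g : Euc n → ℝ, ContDiff ℝ ((⊤ : ℕ∞) : WithTop ℕ∞) g ∧
      (∀ x, |g x - f x| ≤ C * ε ^ (σ : ℝ)) ∧ ∀ x y, |g x - g y| ≤ C * dist x y ^ (σ : ℝ) := by
  have hcont : Continuous f := by
    have : HolderWith C σ f := fun x y => by
      rw [edist_dist, edist_dist, ENNReal.ofReal_rpow_of_nonneg dist_nonneg (by positivity),
        ← ENNReal.ofReal_coe_nnreal, ← ENNReal.ofReal_mul (by positivity)]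
      exact ENNReal.ofReal_le_ofReal (hf x y)
    exact this.continuous hσ0
  let ρ : ContDiffBump (0 : Euc n) := ⟨ε / 2, ε, half_pos hε, half_lt_self hε⟩
  let g : Euc n → ℝ := convolution (ρ.normed volume) f (ContinuousLinearMap.lsmul ℝ ℝ) volume
  have hint : ∀ x, Integrable fun t => ρ.normed volume t * f (x - t) := fun x =>
    (ρ.continuous_normed.mul (hcont.comp (by fun_prop))).integrable_of_hasCompactSupport
      ρ.hasCompactSupport_normed.mul_right
  refine ⟨g, ρ.hasCompactSupport_normed.contDiff_convolution_left _ ρ.contDiff_normed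
    hcont.locallyIntegrable, fun x => ?_, fun x y => ?_⟩
  · refine ρ.dist_normed_convolution_le hcont.aestronglyMeasurable fun y hy => ?_
    refine (hf y x).trans ?_
    gcongr
    exact (Metric.mem_ball.1 hy).le
  · have h1 : g x - g y = ∫ t, ρ.normed volume t * (f (x - t) - f (y - t)) := by
      simp_rw [mul_sub]
      exact (integral_sub (hint x) (hint y)).symm
    have h2 : ∫ t, ρ.normed volume t * (C * dist x y ^ (σ : ℝ)) = C * dist x y ^ (σ : ℝ) := by
      rw [integral_mul_const, ρ.integral_normed, one_mul]
    rw [h1, ← h2, ← Real.norm_eq_abs]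
    refine norm_integral_le_of_norm_le (ρ.integrable_normed.mul_const _) (.of_forall fun t => ?_)
    rw [norm_mul, Real.norm_of_nonneg (ρ.nonneg_normed t), Real.norm_eq_abs]
    refine mul_le_mul_of_nonneg_left ?_ (ρ.nonneg_normed t)
    simpa using hf (x - t) (y - t)

theorem EuclideanSpace.norm_le_of_abs_le {n : ℕ} {v : Euc n} {c : ℝ} (h : ∀ i, |v i| ≤ c) :
    ‖v‖ ≤ n * c := by
  rw [← (EuclideanSpace.basisFun (Fin n) ℝ).sum_repr v]
  refine (norm_sum_le _ _).trans ?_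
  refine (Finset.sum_le_card_nsmul _ _ c fun i _ => ?_).trans (by simp)
  simpa [norm_smul] using h i

/-- Every `C^σ` map of the sphere has a smooth approximation: extend its coordinates to `ℝᵏ⁺¹`,
mollify, and restrict. Convergence in `C^β` for `β < σ` follows by interpolation between uniform
convergence and the uniform bound on the `σ`-Hölder seminorms. -/
theorem exists_isSmoothApprox {k N : ℕ} {σ : ℝ≥0} (hσ0 : 0 < σ) (hσ1 : σ ≤ 1)
    {φ : Sph k → Euc N} (hφ : MemHolder σ φ) : ∃ ψ, IsSmoothApprox σ φ ψ := by
  obtain ⟨C, hC⟩ := hφ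
  have hcoord : ∀ i : Fin N, HolderWith C σ fun x => φ x i := fun i x y => by
    refine le_trans ?_ (hC x y)
    rw [edist_dist, edist_dist]
    refine ENNReal.ofReal_le_ofReal ?_
    rw [dist_eq_norm, dist_eq_norm]
    exact PiLp.norm_apply_le (φ x - φ y) i
  choose Φ hΦ hΦφ using fun i => exists_holder_extension hσ0 hσ1 (hcoord i)
  choose! g hg hgΦ hgg using fun (i : Fin N) (ε : ℝ) (hε : 0 < ε) =>
    exists_contDiff_holder_approx hσ0 (hΦ i) hε
  set D : ℝ := N * C with hD
  have hD0 : 0 ≤ D := by positivity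
  let ψ : ℝ → Sph k → Euc N := fun ε x => WithLp.toLp 2 fun i => g i ε x
  have hclose : ∀ ε > 0, ∀ x, ‖ψ ε x - φ x‖ ≤ D * ε ^ (σ : ℝ) := fun ε hε x => by
    rw [hD, mul_assoc]
    refine EuclideanSpace.norm_le_of_abs_le fun i => ?_
    simpa [ψ, hΦφ] using hgΦ i ε hε x
  have hψh : ∀ ε > 0, ∀ x y, ‖ψ ε x - ψ ε y‖ ≤ D * dist x y ^ (σ : ℝ) := fun ε hε x y => by
    rw [hD, mul_assoc]
    exact EuclideanSpace.norm_le_of_abs_le fun i => hgg i ε hε x y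
  have hφh : ∀ x y, ‖φ x - φ y‖ ≤ D * dist x y ^ (σ : ℝ) := fun x y => by
    rw [hD, mul_assoc]
    exact EuclideanSpace.norm_le_of_abs_le fun i => (hcoord i).dist_le x y
  refine ⟨ψ, fun ε hε => ?_, fun β hβ0 hβσ δ hδ => ?_⟩
  · have : ContDiff ℝ ((⊤ : ℕ∞) : WithTop ℕ∞)
        fun y : Euc (k + 1) => (WithLp.toLp 2 fun i => g i ε y : Euc N) :=
      contDiff_euclidean.2 fun i => hg i ε hε
    exact this.contMDiff.comp (contMDiff_coe_sph k)
  · have hβσ' : (0 : ℝ) < σ - β := sub_pos.2 (by exact_mod_cast hβσ)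
    have hlim : ∀ p : ℝ, 0 < p → ∀ᶠ ε in 𝓝[>] (0 : ℝ), 2 * D * ε ^ p ≤ δ := fun p hp => by
      have h1 : Tendsto (fun ε : ℝ => 2 * D * ε ^ p) (𝓝 0) (𝓝 (2 * D * 0 ^ p)) :=
        ((Real.continuousAt_rpow_const 0 p (.inr hp.le)).tendsto).const_mul _
      rw [Real.zero_rpow hp.ne', mul_zero] at h1
      exact (h1.mono_left nhdsWithin_le_nhds).eventually_le_const hδ
    filter_upwards [hlim σ (by exact_mod_cast hσ0), hlim (σ - β) hβσ', self_mem_nhdsWithin]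
      with ε h1 h2 hε
    have hε : 0 < ε := hε
    have hεσ : 0 ≤ ε ^ (σ : ℝ) := by positivity
    refine ⟨fun x => (hclose ε hε x).trans (by nlinarith), fun x y => ?_⟩
    have hsplit : ∀ r : ℝ, 0 ≤ r → r ^ (σ : ℝ) = r ^ ((σ : ℝ) - β) * r ^ (β : ℝ) := fun r hr => by
      rw [← Real.rpow_add_of_nonneg hr hβσ'.le (by positivity), sub_add_cancel]
    have hβ0' : (0 : ℝ) ≤ β := by positivity
    -- Compare `dist x y` with `ε`: the Hölder bounds serve below, the uniform bounds above.
    have hmain : ‖(ψ ε x - φ x) - (ψ ε y - φ y)‖ ≤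
        2 * D * ε ^ ((σ : ℝ) - β) * dist x y ^ (β : ℝ) := by
      rcases le_total (dist x y) ε with hd | hd
      · calc ‖(ψ ε x - φ x) - (ψ ε y - φ y)‖ = ‖(ψ ε x - ψ ε y) - (φ x - φ y)‖ := by
              congr 1; abel
          _ ≤ 2 * D * dist x y ^ (σ : ℝ) := by
              linarith [norm_sub_le (ψ ε x - ψ ε y) (φ x - φ y), hψh ε hε x y, hφh x y]
          _ ≤ _ := by
              rw [hsplit _ dist_nonneg, ← mul_assoc]
              gcongr
      · calc ‖(ψ ε x - φ x) - (ψ ε y - φ y)‖ ≤ 2 * D * ε ^ (σ : ℝ) := by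
              linarith [norm_sub_le (ψ ε x - φ x) (ψ ε y - φ y), hclose ε hε x, hclose ε hε y]
          _ ≤ _ := by
              rw [hsplit _ hε.le, ← mul_assoc]
              gcongr
    refine hmain.trans ?_
    gcongr

/-! ### The linking form of an embedded sphere -/

/-- A continuous function of the points of an embedded sphere is, up to any `δ > 0`, the restriction
of a smooth function on `ℝᴺ`. The admissible values `t z` at a point `z` form a convex set, and
constants are admissible locally, so a partition of unity gives the function. -/
theorem exists_contDiff_approx_of_isEmbedding {k N : ℕ} {φ : Sph k → Euc N}
    (hφ : IsEmbedding φ) {F : Type*} [NormedAddCommGroup F] [NormedSpace ℝ F] {h : Sph k → F}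
    (hh : Continuous h) {δ : ℝ} (hδ : 0 < δ) :
    ∃ G : Euc N → F, ContDiff ℝ ((⊤ : ℕ∞) : WithTop ℕ∞) G ∧ ∀ x, ‖G (φ x) - h x‖ ≤ δ := by
  let t : Euc N → Set F := fun z => ⋂ x ∈ φ ⁻¹' {z}, Metric.closedBall (h x) δ
  have ht : ∀ z, Convex ℝ (t z) := fun z => convex_iInter₂ fun x _ => convex_closedBall _ _
  have hloc : ∀ z, ∃ c, ∀ᶠ y in 𝓝 z, c ∈ t y := by
    intro z
    by_cases hz : z ∈ range φ
    · obtain ⟨x, rfl⟩ := hz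
      refine ⟨h x, ?_⟩
      have h1 : ∀ᶠ y in 𝓝 x, dist (h y) (h x) < δ := hh.continuousAt.eventually
        (Metric.ball_mem_nhds _ hδ)
      rw [hφ.nhds_eq_comap, eventually_comap] at h1
      filter_upwards [h1] with y hy
      refine mem_iInter₂.2 fun x' hx' => ?_
      rw [Metric.mem_closedBall, dist_comm]
      exact (hy x' hx').le
    · refine ⟨0, ?_⟩
      have hcl : IsClosed (range φ) := (isCompact_range hφ.continuous).isClosed
      filter_upwards [hcl.isOpen_compl.mem_nhds hz] with y hy
      exact mem_iInter₂.2 fun x' hx' => absurd ⟨x', hx'⟩ hy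
  obtain ⟨G, hG⟩ := exists_contMDiffMap_forall_mem_convex_of_local_const 𝓘(ℝ, Euc N)
    (n := (⊤ : ℕ∞)) ht hloc
  refine ⟨G, contMDiff_iff_contDiff.1 G.contMDiff, fun x => ?_⟩
  have := mem_iInter₂.1 (hG (φ x)) x rfl
  rwa [Metric.mem_closedBall, dist_eq_norm] at this

theorem mainTheorem2 (k N : ℕ) (hkN : k + 1 < N) (σ : ℝ≥0)
    (hσ : (k : ℝ) / ((k : ℝ) + 1) < (σ : ℝ)) (hσ1 : σ ≤ 1)
    (φ : Sph k → Euc N) (hφ : MemHolder σ φ) (hemb : IsEmbedding φ) :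
    ∃ ω : DForm N k, ContDiff ℝ ((⊤ : ℕ∞) : WithTop ℕ∞) ω ∧
      ∃ L : ℝ, HasLinkingNumber σ φ (extDeriv ω) L ∧ L ≠ 0 := by
  have hσ0 : 0 < σ := by
    have : (0 : ℝ) < σ := lt_of_le_of_lt (by positivity) hσ
    exact_mod_cast this
  -- The radius `4` keeps the homotopy below in the region `2 < |y|`, where `smoothDir` is
  -- `y / |y|`.
  let ι : Sph k → Euc (k + 1) := fun x => (4 : ℝ) • (x : Euc (k + 1))
  have hι : ContMDiff (𝓡 k) 𝓘(ℝ, Euc (k + 1)) ((⊤ : ℕ∞) : WithTop ℕ∞) ι :=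
    (contDiff_const_smul (4 : ℝ)).contMDiff.comp (contMDiff_coe_sph k)
  have hιn : ∀ x, ‖ι x‖ = 4 := fun x => by simp [ι, norm_smul]
  obtain ⟨G, hG, hGφ⟩ := exists_contDiff_approx_of_isEmbedding hemb hι.continuous
    (show (0 : ℝ) < 1 / 2 by norm_num)
  -- `τ` restricts to the area form of the unit sphere, and `θ` is the solid angle form where
  -- `|y| > 2`.
  let τ : DForm (k + 1) k := fun y => (volForm (k + 1)).curryLeft y
  have hτ : ContDiff ℝ ((⊤ : ℕ∞) : WithTop ℕ∞) τ := (volForm (k + 1)).curryLeft.contDiff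
  let θ : DForm (k + 1) k := DForm.pullback (smoothDir k) τ
  have hθ : ContDiff ℝ ((⊤ : ℕ∞) : WithTop ℕ∞) θ :=
    DForm.contDiff_pullback (contDiff_smoothDir k) hτ
  have hω : ContDiff ℝ ((⊤ : ℕ∞) : WithTop ℕ∞) (DForm.pullback G θ) := DForm.contDiff_pullback hG hθ
  refine ⟨DForm.pullback G θ, hω, sphereIntegral ((↑) : Sph k → Euc (k + 1)) τ,
    ⟨⟨_, hω, rfl⟩, exists_isSmoothApprox hσ0 hσ1 hφ, fun ω' hω' hdω' ψ hψ => ?_⟩,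
    (sphereIntegral_coe_volForm_pos k).ne'⟩
  have hunif := (isCompact_range hemb.continuous).uniformContinuousAt_of_continuousAt G
    (fun z _ => hG.continuous.continuousAt) (Metric.dist_mem_uniformity (one_half_pos (α := ℝ)))
  obtain ⟨δ, hδ, hδG⟩ := Metric.mem_uniformity_dist.1 hunif
  refine tendsto_const_nhds.congr' ?_
  -- Only uniform convergence is used here, so any exponent in `(0, σ)` will do.
  filter_upwards [hψ.tendsto (σ / 2) (half_pos hσ0) (half_lt_self hσ0) (δ / 2) (half_pos hδ),
    self_mem_nhdsWithin] with ε hε hε0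
  have hψε := hψ.smooth ε hε0
  have hclose : ∀ x, ‖G (ψ ε x) - ι x‖ ≤ 1 := fun x => by
    have h1 : dist (φ x) (ψ ε x) < δ := by
      rw [dist_comm, dist_eq_norm]
      linarith [hε.1 x]
    have h2 : dist (G (φ x)) (G (ψ ε x)) < 1 / 2 := hδG h1 (mem_range_self x)
    rw [dist_comm, dist_eq_norm] at h2
    linarith [norm_sub_le_norm_sub_add_norm_sub (G (ψ ε x)) (G (φ x)) (ι x), hGφ x]
  calc sphereIntegral ((↑) : Sph k → Euc (k + 1)) τ
      = sphereIntegral (fun x => smoothDir k (ι x)) τ := by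
        congr 1
        funext x
        rw [smoothDir_eq (by rw [hιn]; norm_num), radialExt_smul _ four_pos, radialExt_coe]
    _ = sphereIntegral ι θ := (sphereIntegral_pullback hι (contDiff_smoothDir k) τ).symm
    _ = sphereIntegral (fun x => G (ψ ε x)) θ := by
        refine sphereIntegral_eq_of_closed_segment hι (hG.contMDiff.comp hψε) hθ fun x t ht => ?_
        refine extDeriv_pullback_smoothDir hτ ?_
        have h1 : ‖t • (G (ψ ε x) - ι x)‖ ≤ 1 := by
          rw [norm_smul, Real.norm_of_nonneg ht.1]
          exact mul_le_one₀ ht.2 (norm_nonneg _) (hclose x)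
        have h2 := norm_sub_le_norm_add (ι x) (t • (G (ψ ε x) - ι x))
        rw [hιn] at h2
        change 2 < ‖ι x + t • (G (ψ ε x) - ι x)‖
        linarith
    _ = sphereIntegral (ψ ε) (DForm.pullback G θ) := (sphereIntegral_pullback hψε hG θ).symm
    _ = sphereIntegral (ψ ε) ω' := (sphereIntegral_eq_of_extDeriv_eq hψε hω hω' hdω').symm
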